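/- Let $M^n$ be a smooth Riemannian manifold with curvature tensor $R$, and let $g: M^n\to\mathbb{R}^{n+p}$ be a smooth isometric immersion with second fundamental form $\alpha: TM\times TM\to T_g^{\perp}M$. For $x\in M^n$ let $$\Gamma(x)=\{X\in T_xM : R(X,Y)=0 \ \ \forall\, Y\in T_xM\},\qquad \Delta_g(x)=\{X\in T_xM : \alpha(X,Y)=0\ \ \forall\, Y\in T_xM\}$$ be the nullity of $M^n$ and the relative nullity of $g$ at $x$, and set $\mu(x)=\dim\Gamma(x)$ and $\nu_g(x)=\dim\Delta_g(x)$. (One always has $\nu_g\le\mu\le\nu_g+p$, by Chern and Kuiper.) Suppose that the upper bound is attained, that is, $$\mu(x)=\nu_g(x)+p\qquad\text{for every } x\in M^n .$$ Then $M^n$ is flat, i.e. $R\equiv 0$. In particular, $\mu(x)=\nu_g(x)+p=n$ for every $x\in M^n$. -/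

import Mathlib

set_option maxSynthPendingDepth 3

open scoped ContDiff Manifold

namespace ChernKuiper

/-- Euclidean space `ℝⁿ` with its standard inner product. -/
abbrev Euc (n : ℕ) : Type := EuclideanSpace ℝ (Fin n)

/-- A (smooth) Riemannian metric on the `n`-dimensional smooth manifold `M`. -/
abbrev Metric (n : ℕ) (M : Type*) [TopologicalSpace M] [ChartedSpace (Euc n) M]
    [IsManifold (𝓡 n) ∞ M] : Type _ :=
  Bundle.ContMDiffRiemannianMetric (𝓡 n) ∞ (Euc n) (fun x : M => TangentSpace (𝓡 n) x)

/-! ### Christoffel symbols and curvature on an open subset of a vector space (such as `ℝⁿ`) -/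

section Local

variable {E : Type*} [NormedAddCommGroup E] [NormedSpace ℝ E]

/-- The Christoffel symbols of the first kind of `G = (G_y)` (a field of bilinear forms on `E`),
`(u, v, w) ↦ ½ (∂_u G(v, w) + ∂_v G(u, w) - ∂_w G(u, v))`; see `christoffelFirst_apply`. -/
noncomputable def christoffelFirst (G : E → E →L[ℝ] E →L[ℝ] ℝ) (y : E) :
    E →L[ℝ] E →L[ℝ] (E →L[ℝ] ℝ) :=
  let D : E →L[ℝ] E →L[ℝ] (E →L[ℝ] ℝ) := fderiv ℝ G y
  let T : (E →L[ℝ] E →L[ℝ] ℝ) →L[ℝ] (E →L[ℝ] E →L[ℝ] ℝ) :=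
    (ContinuousLinearMap.flipₗᵢ ℝ E E ℝ).toContinuousLinearEquiv
  (1 / 2 : ℝ) • (D + D.flip - T ∘L D.flip)

theorem christoffelFirst_apply (G : E → E →L[ℝ] E →L[ℝ] ℝ) (y u v w : E) :
    christoffelFirst G y u v w =
      1 / 2 * (fderiv ℝ G y u v w + fderiv ℝ G y v u w - fderiv ℝ G y w u v) := by
  simp [christoffelFirst]

/-- The Christoffel symbols (of the second kind) of a metric `G`: `Γ_y(u, v) ∈ E` is the vector
with `G_y(Γ_y(u, v), w) = ½ (∂_u G(v, w) + ∂_v G(u, w) - ∂_w G(u, v))` for all `w`. That is,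
`Γ_y(u, v) = ∇_u v` for the constant vector fields `u`, `v`, where `∇` is the Levi-Civita connection
of `G`. Here `G_y` is read as a map from `E` to its dual, and inverted. -/
noncomputable def christoffel (G : E → E →L[ℝ] E →L[ℝ] ℝ) (y : E) :
    E →L[ℝ] E →L[ℝ] E :=
  (ContinuousLinearMap.compL ℝ E (E →L[ℝ] ℝ) E (G y).inverse)
    ∘L christoffelFirst G y

theorem christoffel_apply (G : E → E →L[ℝ] E →L[ℝ] ℝ) (y u v : E) :
    christoffel G y u v = (G y).inverse (christoffelFirst G y u v) := rfl

/-- At a point where `G` is positive definite, the Christoffel symbols satisfy their defining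
equation. -/
theorem metric_christoffel [FiniteDimensional ℝ E] (G : E → E →L[ℝ] E →L[ℝ] ℝ) (y u v w : E)
    (hG : ∀ z, z ≠ 0 → 0 < G y z z) :
    G y (christoffel G y u v) w =
      1 / 2 * (fderiv ℝ G y u v w + fderiv ℝ G y v u w - fderiv ℝ G y w u v) := by
  have hinj : Function.Injective (G y) := by
    refine (injective_iff_map_eq_zero _).2 fun z hz => ?_
    by_contra h
    have := hG z h
    rw [hz] at this
    simp at this
  have hinv : (G y).IsInvertible := by
    have hfr : Module.finrank ℝ E = Module.finrank ℝ (E →L[ℝ] ℝ) := by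
      rw [← LinearMap.toContinuousLinearMap.finrank_eq (R := ℝ) (M := E →ₗ[ℝ] ℝ)]
      exact (Subspace.dual_finrank_eq (K := ℝ) (V := E)).symm
    exact ⟨(LinearEquiv.ofInjectiveOfFinrankEq (G y).toLinearMap hinj hfr).toContinuousLinearEquiv,
      by ext; rfl⟩
  rw [christoffel_apply, hinv.self_apply_inverse, christoffelFirst_apply]

/-- The curvature tensor of a metric `G`, with `R(u, v) w = ∇_u ∇_v w - ∇_v ∇_u w` for constant
vector fields `u`, `v`, `w`, i.e.
`R(u, v) w = (∂_u Γ)(v, w) - (∂_v Γ)(u, w) + Γ(u, Γ(v, w)) - Γ(v, Γ(u, w))`;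
see `localCurvature_apply`. -/
noncomputable def localCurvature (G : E → E →L[ℝ] E →L[ℝ] ℝ) (y : E) :
    E →ₗ[ℝ] E →ₗ[ℝ] E →ₗ[ℝ] E :=
  LinearMap.mk₂ ℝ
    (fun u v => (fderiv ℝ (christoffel G) y u v - fderiv ℝ (christoffel G) y v u
      + christoffel G y u ∘L christoffel G y v
      - christoffel G y v ∘L christoffel G y u).toLinearMap)
    (by intros; ext1; simp; abel) (by intros; ext1; simp [smul_add, smul_sub])
    (by intros; ext1; simp; abel) (by intros; ext1; simp [smul_add, smul_sub])

theorem localCurvature_apply (G : E → E →L[ℝ] E →L[ℝ] ℝ) (y u v w : E) :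
    localCurvature G y u v w =
      fderiv ℝ (christoffel G) y u v w - fderiv ℝ (christoffel G) y v u w
      + christoffel G y u (christoffel G y v w) - christoffel G y v (christoffel G y u w) := rfl

end Local

/-! ### The curvature tensor and the nullity of a Riemannian manifold -/

section Intrinsic

variable {n : ℕ} {M : Type*} [TopologicalSpace M] [ChartedSpace (Euc n) M] [IsManifold (𝓡 n) ∞ M]

/-- The coordinate expression of the metric `m` in the preferred chart `φ` at `x`:
`(G_y)(u, v) = m(d(φ⁻¹)_y u, d(φ⁻¹)_y v)` for `y` in the (open) image of `φ`. -/
noncomputable def chartMetric (m : Metric n M) (x : M) (y : Euc n) :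
    Euc n →L[ℝ] Euc n →L[ℝ] ℝ :=
  let q : M := (extChartAt (𝓡 n) x).symm y
  let B : Euc n →L[ℝ] Euc n →L[ℝ] ℝ := m.inner q
  let d : Euc n →L[ℝ] Euc n := mfderiv 𝓘(ℝ, Euc n) (𝓡 n) (extChartAt (𝓡 n) x).symm y
  B.bilinearComp d d

/-- The curvature tensor `R_x : T_xM × T_xM × T_xM → T_xM` of the Riemannian manifold `(M, m)`,
`(X, Y, Z) ↦ R(X, Y) Z`, computed in the preferred chart at `x`. (In Mathlib, `T_xM` is by
definition the space `ℝⁿ` of coordinate vectors with respect to the preferred chart at `x`.) -/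
noncomputable def curvature (m : Metric n M) (x : M) :
    TangentSpace (𝓡 n) x →ₗ[ℝ] TangentSpace (𝓡 n) x →ₗ[ℝ]
      TangentSpace (𝓡 n) x →ₗ[ℝ] TangentSpace (𝓡 n) x :=
  localCurvature (chartMetric m x) (extChartAt (𝓡 n) x x)

/-- `(M, m)` is flat: its curvature tensor vanishes identically. -/
def IsFlat (m : Metric n M) : Prop :=
  ∀ (x : M) (X Y Z : TangentSpace (𝓡 n) x), curvature m x X Y Z = 0

/-- The nullity `Γ(x) = {X ∈ T_xM : R(X, Y) = 0 for all Y ∈ T_xM}`. -/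
noncomputable def nullity (m : Metric n M) (x : M) : Submodule ℝ (TangentSpace (𝓡 n) x) where
  carrier := {X | ∀ Y : TangentSpace (𝓡 n) x, curvature m x X Y = 0}
  zero_mem' := by intro Y; simp
  add_mem' := by intro X X' h h' Y; simp [h Y, h' Y]
  smul_mem' := by intro c X h Y; simp [h Y]

/-- `μ(x) = dim Γ(x)`. -/
noncomputable def mu (m : Metric n M) (x : M) : ℕ := Module.finrank ℝ (nullity m x)

end Intrinsic

/-! ### Isometric immersions, second fundamental form and relative nullity -/

section Extrinsic

variable {n N : ℕ} {M : Type*} [TopologicalSpace M] [ChartedSpace (Euc n) M]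

/-- The differential `g_* : T_xM → ℝᴺ` of `g : M → ℝᴺ` at `x`. -/
noncomputable def differential (g : M → Euc N) (x : M) : TangentSpace (𝓡 n) x →L[ℝ] Euc N :=
  mfderiv (𝓡 n) 𝓘(ℝ, Euc N) g x

/-- `g : (M, m) → ℝᴺ` is a smooth isometric immersion. (Injectivity of the differential follows
from the positivity of `m`.) -/
def IsIsometricImmersion [IsManifold (𝓡 n) ∞ M] (m : Metric n M) (g : M → Euc N) : Prop :=
  ContMDiff (𝓡 n) 𝓘(ℝ, Euc N) ∞ g ∧
    ∀ (x : M) (X Y : TangentSpace (𝓡 n) x),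
      inner ℝ (differential (n := n) g x X) (differential (n := n) g x Y) = m.inner x X Y

/-- The component `(u, v) ↦ (B(u, v))_K ∈ K` in a subspace `K` of a bilinear map `B`. -/
noncomputable def normalComponent (K : Submodule ℝ (Euc N))
    (B : Euc n →L[ℝ] Euc n →L[ℝ] Euc N) : Euc n →ₗ[ℝ] Euc n →ₗ[ℝ] K :=
  LinearMap.mk₂ ℝ (fun u v => K.orthogonalProjectionOnto (B u v))
    (by intros; simp) (by intros; simp) (by intros; simp) (by intros; simp)

/-- The normal space `T_g^⊥M(x)`, the orthogonal complement of `g_* T_xM` in `ℝᴺ`. -/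
noncomputable def normalSpace (n : ℕ) {M : Type*} [TopologicalSpace M] [ChartedSpace (Euc n) M]
    (g : M → Euc N) (x : M) : Submodule ℝ (Euc N) :=
  (LinearMap.range (differential (n := n) g x).toLinearMap)ᗮ

/-- The second fundamental form `α_x : T_xM × T_xM → T_g^⊥M(x)`: the normal component of the second
derivative of `g`, read in the preferred chart `φ` at `x`. That is, `α(X, Y)` is the normal
component of the derivative in the direction `X` of `g_* Y`, where `Y` is extended to the vector
field with constant coordinates in the chart. -/
noncomputable def secondFundamentalForm (g : M → Euc N) (x : M) :
    TangentSpace (𝓡 n) x →ₗ[ℝ] TangentSpace (𝓡 n) x →ₗ[ℝ] normalSpace n g x :=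
  normalComponent (normalSpace n g x)
    (fderiv ℝ (fderiv ℝ (g ∘ (extChartAt (𝓡 n) x).symm)) (extChartAt (𝓡 n) x x))

/-- The relative nullity `Δ_g(x) = {X ∈ T_xM : α(X, Y) = 0 for all Y ∈ T_xM}`. -/
noncomputable def relativeNullity (g : M → Euc N) (x : M) :
    Submodule ℝ (TangentSpace (𝓡 n) x) where
  carrier := {X | ∀ Y : TangentSpace (𝓡 n) x, secondFundamentalForm g x X Y = 0}
  zero_mem' := by intro Y; simp
  add_mem' := by intro X X' h h' Y; simp [h Y, h' Y]
  smul_mem' := by intro c X h Y; simp [h Y]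

/-- `ν_g(x) = dim Δ_g(x)`. -/
noncomputable def nu (n : ℕ) {M : Type*} [TopologicalSpace M] [ChartedSpace (Euc n) M]
    (g : M → Euc N) (x : M) : ℕ :=
  Module.finrank ℝ (relativeNullity (n := n) g x)

end Extrinsic

end ChernKuiper

/-! The argument is pointwise. By the Gauss equation (`gauss`), `X` lies in `Γ(x)` iff `⟨α(X,Z),
α(Y,U)⟩ = ⟨α(X,U), α(Y,Z)⟩` for all `Y, Z, U`, and `R = 0` at `x` iff this holds for every `X`. The
rest is algebra of `α` (`flat_of_finrank_eq`).

Write `β_Y X = α(X, Y)` for `X ∈ Γ`. This is a flat bilinear map, so some `e` satisfies `ker β_e ⊆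
ker β_Y` for all `Y` (`exists_regular`); thus `ker β_e ⊆ Δ`. Since `μ = ν + p`, `β_e` maps `Γ` onto
the `p`-dimensional normal space, and `B_Y (β_e X) = β_Y X` defines endomorphisms of it. Flatness
makes them self-adjoint and commuting, and `α(Y, U) = B_U B_Y α(e, e)`. The Gauss expression then
has the required symmetry on all of `T_xM`. -/

namespace ChernKuiper

open scoped Topology

/-! ### Flat bilinear maps and the algebraic equality case -/

section FlatBilinear

variable {S V W : Type*} [AddCommGroup S] [Module ℝ S] [AddCommGroup V] [Module ℝ V]
  [NormedAddCommGroup W] [InnerProductSpace ℝ W] [FiniteDimensional ℝ W]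

/-- For a flat bilinear map `β`, some member of the pencil `β_Z + t β_Y` has kernel
contained in `ker β_Y`. -/
theorem exists_ker_pencil_le (β : V →ₗ[ℝ] S →ₗ[ℝ] W)
    (hβ : ∀ Y Z X X', inner ℝ (β Y X) (β Z X') = inner ℝ (β Z X) (β Y X')) (Y Z : V) :
    ∃ t : ℝ, ∀ X, β (Z + t • Y) X = 0 → β Y X = 0 := by
  by_contra! h
  choose K hK hK' using h
  have hKeq : ∀ t, β Z (K t) = -(t • β Y (K t)) := fun t => by
    have := hK t
    simp only [map_add, map_smul, LinearMap.add_apply, LinearMap.smul_apply] at this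
    exact eq_neg_of_add_eq_zero_left this
  -- As for eigenvectors with distinct eigenvalues, flatness gives `(s - t)⟨β_Y K_s, β_Y K_t⟩ = 0`.
  -- A nonzero orthogonal family indexed by `ℝ` cannot fit in `W`.
  have hli : LinearIndependent ℝ fun t => β Y (K t) := by
    refine linearIndependent_of_ne_zero_of_inner_eq_zero hK' fun s t hst => ?_
    have := hβ Y Z (K s) (K t)
    rw [hKeq, hKeq, inner_neg_left, inner_neg_right, real_inner_smul_left,
      real_inner_smul_right] at this
    have h0 : (s - t) * inner ℝ (β Y (K s)) (β Y (K t)) = 0 := by linarith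
    exact (mul_eq_zero.1 h0).resolve_left (sub_ne_zero.2 hst)
  have : Finite ℝ := hli.finite
  exact not_finite ℝ

/-- A flat bilinear map has a regular element: some `ker β_Z` is the intersection of all the
kernels. -/
theorem exists_regular [FiniteDimensional ℝ S] (β : V →ₗ[ℝ] S →ₗ[ℝ] W)
    (hβ : ∀ Y Z X X', inner ℝ (β Y X) (β Z X') = inner ℝ (β Z X) (β Y X')) :
    ∃ Z : V, ∀ X, β Z X = 0 → ∀ Y, β Y X = 0 := by
  obtain ⟨Z, hZ⟩ : ∃ Z, ∀ Y, Module.finrank ℝ (LinearMap.ker (β Z)) ≤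
      Module.finrank ℝ (LinearMap.ker (β Y)) :=
    ⟨Function.argmin (fun Z => Module.finrank ℝ (LinearMap.ker (β Z))),
      fun Y => Function.argmin_le (fun Z => Module.finrank ℝ (LinearMap.ker (β Z))) Y⟩
  refine ⟨Z, fun X hX Y => ?_⟩
  obtain ⟨t, ht⟩ := exists_ker_pencil_le β hβ Y Z
  -- A vector killed by `β_{Z+tY}` is killed by `β_Y`, hence by `β_Z`; minimality of `dim ker β_Z`
  -- turns the inclusion into equality.
  have hle : LinearMap.ker (β (Z + t • Y)) ≤ LinearMap.ker (β Z) := fun X hX => by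
    have h1 := ht X hX
    simpa [h1] using hX
  have heq := Submodule.eq_of_le_of_finrank_le hle (hZ _)
  have hX' : X ∈ LinearMap.ker (β (Z + t • Y)) := by rw [heq]; exact hX
  exact ht X hX'

/-- A symmetric bilinear map into a Euclidean space of dimension `p` satisfies the Gauss equation of
a flat metric as soon as its Gauss nullity exceeds its nullity by `p`. -/
theorem flat_of_finrank_eq [FiniteDimensional ℝ V] (α : V →ₗ[ℝ] V →ₗ[ℝ] W)
    (hα : ∀ X Y, α X Y = α Y X) (Γ Δ : Submodule ℝ V)
    (hΓ : ∀ X ∈ Γ, ∀ Y Z U, inner ℝ (α X Z) (α Y U) = inner ℝ (α X U) (α Y Z))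
    (hΔ : ∀ X, (∀ Y, α X Y = 0) → X ∈ Δ)
    (hdim : Module.finrank ℝ Γ = Module.finrank ℝ Δ + Module.finrank ℝ W) (X Y Z U : V) :
    inner ℝ (α X Z) (α Y U) = inner ℝ (α X U) (α Y Z) := by
  let β : V →ₗ[ℝ] Γ →ₗ[ℝ] W := (α.domRestrict Γ).flip
  have hβ : ∀ Y Z X X', inner ℝ (β Y X) (β Z X') = inner ℝ (β Z X) (β Y X') :=
    fun Y Z X X' => hΓ X X.2 X' Y Z
  obtain ⟨e, he⟩ := exists_regular β hβ
  have hker : Module.finrank ℝ (LinearMap.ker (β e)) ≤ Module.finrank ℝ Δ := by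
    rw [(Submodule.equivMapOfInjective Γ.subtype Γ.injective_subtype
      (LinearMap.ker (β e))).finrank_eq]
    refine Submodule.finrank_mono ?_
    rintro _ ⟨X, hX, rfl⟩
    exact hΔ _ fun Y => he X hX Y
  have hsurj : LinearMap.range (β e) = ⊤ := by
    refine Submodule.eq_top_of_finrank_eq (le_antisymm (Submodule.finrank_le _) ?_)
    have := (β e).finrank_range_add_finrank_ker
    omega
  obtain ⟨s, hs⟩ := (β e).exists_rightInverse_of_surjective hsurj
  have hs' : ∀ w, β e (s w) = w := fun w => LinearMap.congr_fun hs w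
  -- The choice of section `s` is immaterial, because `ker β_e ⊆ ker β_Y`; this is `hB`.
  let B : V → W →ₗ[ℝ] W := fun Y => β Y ∘ₗ s
  have hB : ∀ Y X, B Y (β e X) = β Y X := fun Y X => by
    have : β e (s (β e X) - X) = 0 := by rw [map_sub, hs', sub_self]
    have := he _ this Y
    rwa [map_sub, sub_eq_zero] at this
  have hBsymm : ∀ Y w w', inner ℝ (B Y w) w' = inner ℝ w (B Y w') := fun Y w w' => by
    have := hβ Y e (s w) (s w')
    rwa [hs', hs'] at this
  have hBcomm : ∀ Y Z w, B Y (B Z w) = B Z (B Y w) := fun Y Z w => by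
    refine ext_inner_right ℝ fun w' => ?_
    exact (hBsymm Y _ _).trans ((hβ Z Y (s w) (s w')).trans (hBsymm Z _ _).symm)
  -- Test against `w = β_e X` with `X ∈ Γ`: the Gauss symmetry for `X` exchanges `e` and `U`, for
  -- arbitrary `Y`.
  have h1 : ∀ Y U, α Y U = B U (α Y e) := fun Y U => by
    refine ext_inner_left ℝ fun w => ?_
    rw [← hBsymm, ← hs' w, hB]
    exact hΓ _ (s w).2 Y e U
  have h2 : ∀ Y U, α Y U = B U (B Y (α e e)) := fun Y U => by
    rw [h1 Y U, hα Y e, h1 e Y]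
  have h3 : ∀ Y Z v w, inner ℝ (B Z (B Y v)) w = inner ℝ v (B Y (B Z w)) := fun Y Z v w => by
    rw [hBsymm, hBsymm]
  -- With `ξ = α(e, e)`, the two sides are `⟨ξ, B_X B_Z B_U B_Y ξ⟩` and `⟨ξ, B_X B_U B_Z B_Y ξ⟩`.
  rw [h2 X Z, h2 Y U, h2 X U, h2 Y Z, h3, h3, hBcomm Z U]

end FlatBilinear

/-! ### The Gauss equation in coordinates -/

section Gauss

variable {E : Type*} [NormedAddCommGroup E] [NormedSpace ℝ E]

theorem isInvertible_of_pos [FiniteDimensional ℝ E] {B : E →L[ℝ] E →L[ℝ] ℝ}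
    (hB : ∀ z, z ≠ 0 → 0 < B z z) : B.IsInvertible := by
  have hinj : Function.Injective B := by
    refine (injective_iff_map_eq_zero _).2 fun z hz => ?_
    by_contra h
    have := hB z h
    rw [hz] at this
    simp at this
  have hfr : Module.finrank ℝ E = Module.finrank ℝ (E →L[ℝ] ℝ) := by
    rw [← LinearMap.toContinuousLinearMap.finrank_eq (R := ℝ) (M := E →ₗ[ℝ] ℝ)]
    exact (Subspace.dual_finrank_eq (K := ℝ) (V := E)).symm
  exact ⟨(LinearEquiv.ofInjectiveOfFinrankEq B.toLinearMap hinj hfr).toContinuousLinearEquiv,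
    by ext; rfl⟩

theorem christoffelFirst_congr {G H : E → E →L[ℝ] E →L[ℝ] ℝ} {y : E} (h : G =ᶠ[𝓝 y] H) :
    christoffelFirst G y = christoffelFirst H y := by
  simp only [christoffelFirst, h.fderiv_eq]

theorem christoffel_congr {G H : E → E →L[ℝ] E →L[ℝ] ℝ} {y : E} (h : G =ᶠ[𝓝 y] H) :
    christoffel G y = christoffel H y := by
  rw [christoffel, christoffel, christoffelFirst_congr h, h.eq_of_nhds]

/-- Curvature depends only on the germ of the metric; needed because the chart metric is identified
with the induced one only on the chart's target. -/
theorem localCurvature_congr {G H : E → E →L[ℝ] E →L[ℝ] ℝ} {y : E} (h : G =ᶠ[𝓝 y] H) :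
    localCurvature G y = localCurvature H y := by
  have hc : christoffel G =ᶠ[𝓝 y] christoffel H :=
    h.eventuallyEq_nhds.mono fun _ hz => christoffel_congr hz
  ext u v w
  rw [localCurvature_apply, localCurvature_apply, hc.fderiv_eq, hc.eq_of_nhds]

theorem differentiableAt_christoffelFirst {G : E → E →L[ℝ] E →L[ℝ] ℝ} {y : E}
    (hG : ContDiffAt ℝ 2 G y) : DifferentiableAt ℝ (christoffelFirst G) y := by
  have hD : DifferentiableAt ℝ (fderiv ℝ G) y :=
    (hG.fderiv_right (m := 1) le_rfl).differentiableAt one_ne_zero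
  have hF : DifferentiableAt ℝ (fun y => (fderiv ℝ G y).flip) y :=
    (ContinuousLinearMap.flipₗᵢ ℝ E E (E →L[ℝ] ℝ)).toContinuousLinearEquiv.differentiableAt.comp
      y hD
  exact ((hD.add hF).sub ((differentiableAt_const _).clm_comp hF)).const_smul (1 / 2 : ℝ)

theorem differentiableAt_christoffel [FiniteDimensional ℝ E] {G : E → E →L[ℝ] E →L[ℝ] ℝ} {y : E}
    (hG : ContDiffAt ℝ 2 G y) (hpos : ∀ z, z ≠ 0 → 0 < G y z z) :
    DifferentiableAt ℝ (christoffel G) y := by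
  have : CompleteSpace E := FiniteDimensional.complete ℝ E
  have hinv : DifferentiableAt ℝ (fun y => (G y).inverse) y := by
    obtain ⟨e, he⟩ := isInvertible_of_pos hpos
    have h1 : ContDiffAt ℝ 1 (ContinuousLinearMap.inverse (R := ℝ) (M := E) (M₂ := E →L[ℝ] ℝ))
        (G y) := he ▸ contDiffAt_map_inverse e
    exact (h1.differentiableAt one_ne_zero).comp y (hG.differentiableAt two_ne_zero)
  exact ((ContinuousLinearMap.compL ℝ E (E →L[ℝ] ℝ) E).differentiableAt.comp y hinv).clm_comp
    (differentiableAt_christoffelFirst hG)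

variable {F : Type*} [NormedAddCommGroup F] [InnerProductSpace ℝ F]

/-- The metric induced by a map `f`. -/
noncomputable def inducedMetric (f : E → F) (y : E) : E →L[ℝ] E →L[ℝ] ℝ :=
  (innerSL ℝ).bilinearComp (fderiv ℝ f y) (fderiv ℝ f y)

theorem inducedMetric_apply (f : E → F) (y u v : E) :
    inducedMetric f y u v = inner ℝ (fderiv ℝ f y u) (fderiv ℝ f y v) := rfl

/-- The second derivative of `f` minus `f_* Γ(u, v)`: the normal component of the second derivative
at an immersed point, see `inner_normalHessian_fderiv`. -/
noncomputable def normalHessian (f : E → F) (y u v : E) : F :=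
  fderiv ℝ (fderiv ℝ f) y u v - fderiv ℝ f y (christoffel (inducedMetric f) y u v)

variable {f : E → F} {y : E}

theorem contDiffAt_inducedMetric (hf : ContDiffAt ℝ 3 f y) :
    ContDiffAt ℝ 2 (inducedMetric f) y := by
  have hD : ContDiffAt ℝ 2 (fderiv ℝ f) y := hf.fderiv_right (m := 2) le_rfl
  have h1 : ContDiffAt ℝ 2 (fun y => (innerSL ℝ (E := F)).comp (fderiv ℝ f y)) y :=
    contDiffAt_const.clm_comp hD
  have h2 : ContDiffAt ℝ 2 (fun y => ((innerSL ℝ (E := F)).comp (fderiv ℝ f y)).flip) y :=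
    (ContinuousLinearMap.flipₗᵢ ℝ E F ℝ).contDiff.contDiffAt.comp y h1
  exact (ContinuousLinearMap.flipₗᵢ ℝ E E ℝ).contDiff.contDiffAt.comp y (h2.clm_comp hD)

theorem fderiv_inducedMetric (hf : ContDiffAt ℝ 2 f y) (hG : DifferentiableAt ℝ (inducedMetric f) y)
    (u v w : E) :
    fderiv ℝ (inducedMetric f) y u v w =
      inner ℝ (fderiv ℝ (fderiv ℝ f) y u v) (fderiv ℝ f y w) +
        inner ℝ (fderiv ℝ f y v) (fderiv ℝ (fderiv ℝ f) y u w) := by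
  have hD : HasFDerivAt (fderiv ℝ f) (fderiv ℝ (fderiv ℝ f) y) y :=
    ((hf.fderiv_right (m := 1) le_rfl).differentiableAt one_ne_zero).hasFDerivAt
  have h1 := (hG.hasFDerivAt.clm_apply (hasFDerivAt_const v y)).clm_apply (hasFDerivAt_const w y)
  have h2 := (hD.clm_apply (hasFDerivAt_const v y)).inner ℝ
    (hD.clm_apply (hasFDerivAt_const w y))
  have := DFunLike.congr_fun (h1.unique h2) u
  simpa [add_comm] using this

theorem symm_sndFDeriv (hf : ContDiffAt ℝ 2 f y) (u v : E) :
    fderiv ℝ (fderiv ℝ f) y u v = fderiv ℝ (fderiv ℝ f) y v u :=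
  (hf.isSymmSndFDerivAt (by simp)).eq u v

/-- By the product rule and symmetry of second derivatives, the Christoffel combination of
derivatives of the induced metric collapses to `⟨D²f(u,v), Df w⟩`. -/
theorem inner_normalHessian_fderiv [FiniteDimensional ℝ E] (hf : ContDiffAt ℝ 3 f y)
    (hpos : Function.Injective (fderiv ℝ f y)) (u v w : E) :
    inner ℝ (normalHessian f y u v) (fderiv ℝ f y w) = 0 := by
  have hf2 : ContDiffAt ℝ 2 f y := hf.of_le (by norm_num)
  have hG := (contDiffAt_inducedMetric hf).differentiableAt two_ne_zero
  have h := metric_christoffel (inducedMetric f) y u v w fun z hz => by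
    rw [inducedMetric_apply]
    exact real_inner_self_pos.2 ((map_ne_zero_iff _ hpos).2 hz)
  rw [inducedMetric_apply, fderiv_inducedMetric hf2 hG, fderiv_inducedMetric hf2 hG,
    fderiv_inducedMetric hf2 hG, symm_sndFDeriv hf2 v u, symm_sndFDeriv hf2 w u,
    symm_sndFDeriv hf2 w v] at h
  rw [normalHessian, inner_sub_left, h, real_inner_comm _ (fderiv ℝ f y v)]
  ring

/-- The Gauss equation for the metric induced by an immersion `f`. -/
theorem gauss_equation [FiniteDimensional ℝ E] (hf3 : ContDiffAt ℝ 3 f y)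
    (hinj : ∀ᶠ z in 𝓝 y, Function.Injective (fderiv ℝ f z)) (u v w z : E) :
    inner ℝ (fderiv ℝ f y (localCurvature (inducedMetric f) y u v w)) (fderiv ℝ f y z) =
      inner ℝ (normalHessian f y v w) (normalHessian f y u z) -
        inner ℝ (normalHessian f y u w) (normalHessian f y v z) := by
  have hD1 : ContDiffAt ℝ 2 (fderiv ℝ f) y := hf3.fderiv_right (m := 2) le_rfl
  have hD : HasFDerivAt (fderiv ℝ f) (fderiv ℝ (fderiv ℝ f) y) y :=
    (hD1.differentiableAt two_ne_zero).hasFDerivAt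
  have hDD : HasFDerivAt (fderiv ℝ (fderiv ℝ f)) (fderiv ℝ (fderiv ℝ (fderiv ℝ f)) y) y :=
    ((hD1.fderiv_right (m := 1) le_rfl).differentiableAt one_ne_zero).hasFDerivAt
  have hpos : ∀ z, z ≠ 0 → 0 < inducedMetric f y z z := fun z hz =>
    real_inner_self_pos.2 ((map_ne_zero_iff _ hinj.self_of_nhds).2 hz)
  have hC : HasFDerivAt (christoffel (inducedMetric f))
      (fderiv ℝ (christoffel (inducedMetric f)) y) y :=
    (differentiableAt_christoffel (contDiffAt_inducedMetric hf3) hpos).hasFDerivAt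
  have hev : ∀ᶠ z in 𝓝 y, ContDiffAt ℝ 3 f z := hf3.eventually (by simp)
  -- The derivative along `u` of the identity `⟨normalHessian(v,w), Df z⟩ = 0`, which holds near
  -- `y`. Subtracting the version with `u`, `v` exchanged cancels the third derivatives and leaves
  -- the curvature.
  have key : ∀ u v w z, inner ℝ (fderiv ℝ (fderiv ℝ (fderiv ℝ f)) y u v w
      - fderiv ℝ (fderiv ℝ f) y u (christoffel (inducedMetric f) y v w)
      - fderiv ℝ f y (fderiv ℝ (christoffel (inducedMetric f)) y u v w)) (fderiv ℝ f y z)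
      + inner ℝ (normalHessian f y v w) (fderiv ℝ (fderiv ℝ f) y u z) = 0 := fun u v w z => by
    have h1 := (((hDD.clm_apply (hasFDerivAt_const v y)).clm_apply (hasFDerivAt_const w y)).sub
      (hD.clm_apply ((hC.clm_apply (hasFDerivAt_const v y)).clm_apply
        (hasFDerivAt_const w y)))).inner ℝ (hD.clm_apply (hasFDerivAt_const z y))
    have h0 : (fun x => inner ℝ (normalHessian f x v w) (fderiv ℝ f x z)) =ᶠ[𝓝 y] fun _ => 0 := by
      filter_upwards [hev, hinj] with x hx hx' using inner_normalHessian_fderiv hx hx' v w z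
    have := DFunLike.congr_fun
      (h1.unique ((hasFDerivAt_const (0 : ℝ) y).congr_of_eventuallyEq h0)) u
    simp only [ContinuousLinearMap.comp_zero, zero_add, ContinuousLinearMap.comp_apply,
      ContinuousLinearMap.prod_apply, sub_apply,
      add_apply, ContinuousLinearMap.flip_apply, fderivInnerCLM_apply,
      Pi.sub_apply, zero_apply] at this
    rw [normalHessian, sub_sub, add_comm (fderiv ℝ (fderiv ℝ f) y u _), add_comm]
    exact this
  have hN : ∀ u v w z, inner ℝ (normalHessian f y v w) (fderiv ℝ (fderiv ℝ f) y u z) =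
      inner ℝ (normalHessian f y v w) (normalHessian f y u z) := fun u v w z => by
    rw [normalHessian.eq_def f y u z, inner_sub_right,
      inner_normalHessian_fderiv hf3 hinj.self_of_nhds, sub_zero]
  have hT : ∀ u v w z, inner ℝ (fderiv ℝ (fderiv ℝ f) y u (christoffel (inducedMetric f) y v w))
      (fderiv ℝ f y z) = inner ℝ (fderiv ℝ f y (christoffel (inducedMetric f) y u
        (christoffel (inducedMetric f) y v w))) (fderiv ℝ f y z) := fun u v w z => by
    have := inner_normalHessian_fderiv hf3 hinj.self_of_nhds u (christoffel (inducedMetric f) y v w) z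
    rwa [normalHessian, inner_sub_left, sub_eq_zero] at this
  have k1 := key u v w z
  have k2 := key v u w z
  rw [hN, inner_sub_left, inner_sub_left, hT] at k1 k2
  rw [(hD1.isSymmSndFDerivAt (by simp)).eq v u] at k2
  rw [localCurvature_apply, map_sub, map_add, map_sub, inner_sub_left, inner_add_left,
    inner_sub_left]
  linarith

end Gauss

/-! ### Transfer to the manifold through charts -/

section Manifold

variable {n N : ℕ} {M : Type*} [TopologicalSpace M] [ChartedSpace (Euc n) M] [IsManifold (𝓡 n) ∞ M]
  {m : Metric n M} {g : M → Euc N}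

theorem isInvertible_mfderiv_chart_symm (x : M) {y : Euc n}
    (hy : y ∈ (extChartAt (𝓡 n) x).target) :
    (mfderiv 𝓘(ℝ, Euc n) (𝓡 n) (extChartAt (𝓡 n) x).symm y).IsInvertible := by
  have : IsManifold (𝓡 n) 1 M := IsManifold.of_le (n := ∞) (by simp)
  have h := isInvertible_mfderivWithin_extChartAt_symm (I := 𝓡 n) hy
  rwa [ModelWithCorners.range_eq_univ, mfderivWithin_univ] at h

theorem contMDiffAt_chart_symm (x : M) {y : Euc n} (hy : y ∈ (extChartAt (𝓡 n) x).target) :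
    ContMDiffAt 𝓘(ℝ, Euc n) (𝓡 n) ∞ (extChartAt (𝓡 n) x).symm y :=
  (contMDiffOn_extChartAt_symm x).contMDiffAt ((isOpen_extChartAt_target x).mem_nhds hy)

namespace IsIsometricImmersion

theorem contDiffAt (hg : IsIsometricImmersion m g) (x : M) {y : Euc n}
    (hy : y ∈ (extChartAt (𝓡 n) x).target) :
    ContDiffAt ℝ ∞ (g ∘ (extChartAt (𝓡 n) x).symm) y :=
  contMDiffAt_iff_contDiffAt.1 (hg.1.contMDiffAt.comp y (contMDiffAt_chart_symm x hy))

theorem fderiv_apply (hg : IsIsometricImmersion m g) (x : M) {y : Euc n}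
    (hy : y ∈ (extChartAt (𝓡 n) x).target) (u : Euc n) :
    fderiv ℝ (g ∘ (extChartAt (𝓡 n) x).symm) y u =
      differential g ((extChartAt (𝓡 n) x).symm y)
        (mfderiv 𝓘(ℝ, Euc n) (𝓡 n) (extChartAt (𝓡 n) x).symm y u) := by
  rw [← mfderiv_eq_fderiv, mfderiv_comp (I' := 𝓡 n) y
    (hg.1.contMDiffAt.mdifferentiableAt (by simp))
    ((contMDiffAt_chart_symm x hy).mdifferentiableAt (by simp))]
  rfl

theorem differential_injective (hg : IsIsometricImmersion m g) (x : M) :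
    Function.Injective (differential (n := n) g x) := by
  refine (injective_iff_map_eq_zero _).2 fun X hX => ?_
  by_contra h
  have h1 := m.pos x X h
  rw [← hg.2, hX, inner_zero_left] at h1
  exact lt_irrefl _ h1

theorem fderiv_injective (hg : IsIsometricImmersion m g) (x : M) {y : Euc n}
    (hy : y ∈ (extChartAt (𝓡 n) x).target) :
    Function.Injective (fderiv ℝ (g ∘ (extChartAt (𝓡 n) x).symm) y) := by
  have h := (hg.differential_injective _).comp
    (isInvertible_mfderiv_chart_symm x hy).bijective.injective
  intro u v huv
  rw [hg.fderiv_apply x hy, hg.fderiv_apply x hy] at huv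
  exact h huv

theorem chartMetric_eq (hg : IsIsometricImmersion m g) (x : M) {y : Euc n}
    (hy : y ∈ (extChartAt (𝓡 n) x).target) :
    chartMetric m x y = inducedMetric (g ∘ (extChartAt (𝓡 n) x).symm) y := by
  ext u v
  rw [inducedMetric_apply, hg.fderiv_apply x hy, hg.fderiv_apply x hy, hg.2]
  rfl

theorem curvature_eq (hg : IsIsometricImmersion m g) (x : M) :
    curvature m x =
      localCurvature (inducedMetric (g ∘ (extChartAt (𝓡 n) x).symm)) (extChartAt (𝓡 n) x x) := by
  refine localCurvature_congr ?_
  filter_upwards [extChartAt_target_mem_nhds (I := 𝓡 n) x] with y hy using hg.chartMetric_eq x hy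

theorem differential_eq (hg : IsIsometricImmersion m g) (x : M) :
    differential (n := n) g x =
      fderiv ℝ (g ∘ (extChartAt (𝓡 n) x).symm) (extChartAt (𝓡 n) x x) := by
  have h : MDifferentiableAt (𝓡 n) 𝓘(ℝ, Euc N) g x := hg.1.contMDiffAt.mdifferentiableAt (by simp)
  rw [differential, h.mfderiv, ModelWithCorners.range_eq_univ, fderivWithin_univ]
  rfl

theorem secondFundamentalForm_eq (hg : IsIsometricImmersion m g) (x : M)
    (X Y : TangentSpace (𝓡 n) x) :
    (secondFundamentalForm g x X Y : Euc N) =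
      normalHessian (g ∘ (extChartAt (𝓡 n) x).symm) (extChartAt (𝓡 n) x x) X Y := by
  have hx := mem_extChartAt_target (I := 𝓡 n) x
  -- The projection is characterised by two facts: `normalHessian` is normal, and it differs from
  -- the second derivative by the tangent vector `Df(Γ(X,Y))`.
  refine (Submodule.coe_orthogonalProjectionOnto_apply _ _).trans
    (Submodule.eq_starProjection_of_mem_orthogonal ?_ ?_)
  · rw [normalSpace, Submodule.mem_orthogonal']
    rintro _ ⟨Z, rfl⟩
    rw [hg.differential_eq]
    exact inner_normalHessian_fderiv ((hg.contDiffAt x hx).of_le ENat.LEInfty.out)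
      (hg.fderiv_injective x hx) X Y Z
  · rw [normalSpace, Submodule.orthogonal_orthogonal, hg.differential_eq]
    exact ⟨_, (sub_sub_cancel _ _).symm⟩

theorem secondFundamentalForm_symm (hg : IsIsometricImmersion m g) (x : M)
    (X Y : TangentSpace (𝓡 n) x) :
    secondFundamentalForm g x X Y = secondFundamentalForm g x Y X := by
  have h := symm_sndFDeriv ((hg.contDiffAt x (mem_extChartAt_target x)).of_le
    ENat.LEInfty.out) X Y
  exact congrArg (normalSpace n g x).orthogonalProjectionOnto h

/-- The Gauss equation of an isometric immersion. -/
theorem gauss (hg : IsIsometricImmersion m g) (x : M) (X Y Z U : TangentSpace (𝓡 n) x) :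
    m.inner x (curvature m x X Y Z) U =
      inner ℝ (secondFundamentalForm g x Y Z) (secondFundamentalForm g x X U) -
        inner ℝ (secondFundamentalForm g x X Z) (secondFundamentalForm g x Y U) := by
  have hx := mem_extChartAt_target (I := 𝓡 n) x
  have hinj : ∀ᶠ y in 𝓝 (extChartAt (𝓡 n) x x),
      Function.Injective (fderiv ℝ (g ∘ (extChartAt (𝓡 n) x).symm) y) := by
    filter_upwards [extChartAt_target_mem_nhds (I := 𝓡 n) x] with y hy using
      hg.fderiv_injective x hy
  rw [← hg.2, hg.curvature_eq, hg.differential_eq, Submodule.coe_inner, Submodule.coe_inner,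
    hg.secondFundamentalForm_eq, hg.secondFundamentalForm_eq, hg.secondFundamentalForm_eq,
    hg.secondFundamentalForm_eq]
  exact gauss_equation ((hg.contDiffAt x hx).of_le ENat.LEInfty.out) hinj X Y Z U

theorem curvature_eq_zero_iff (hg : IsIsometricImmersion m g) (x : M)
    (X Y Z : TangentSpace (𝓡 n) x) :
    curvature m x X Y Z = 0 ↔ ∀ U,
      inner ℝ (secondFundamentalForm g x X Z) (secondFundamentalForm g x Y U) =
        inner ℝ (secondFundamentalForm g x X U) (secondFundamentalForm g x Y Z) := by
  have key : ∀ U, m.inner x (curvature m x X Y Z) U = 0 ↔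
      inner ℝ (secondFundamentalForm g x X Z) (secondFundamentalForm g x Y U) =
        inner ℝ (secondFundamentalForm g x X U) (secondFundamentalForm g x Y Z) := fun U => by
    rw [hg.gauss, sub_eq_zero, real_inner_comm, eq_comm]
  refine ⟨fun h U => (key U).1 (by rw [h]; simp), fun h => ?_⟩
  by_contra h0
  -- Take `U = R(X,Y)Z` and use positivity of the metric.
  exact (m.pos x _ h0).ne' ((key _).2 (h _))

theorem finrank_normalSpace {p : ℕ} {g : M → Euc (n + p)} (hg : IsIsometricImmersion m g) (x : M) :
    Module.finrank ℝ (normalSpace n g x) = p := by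
  have h := Submodule.finrank_add_finrank_orthogonal
    (LinearMap.range (differential (n := n) g x).toLinearMap)
  have h1 := LinearMap.finrank_range_of_inj (f := (differential (n := n) g x).toLinearMap)
    (hg.differential_injective x)
  have h2 : Module.finrank ℝ (TangentSpace (𝓡 n) x) = n := finrank_euclideanSpace_fin
  rw [h1, h2, finrank_euclideanSpace_fin] at h
  exact Nat.add_left_cancel h

/-- Equality in the Chern–Kuiper inequality at a point forces the curvature there to vanish. -/
theorem curvature_eq_zero {p : ℕ} {g : M → Euc (n + p)} (hg : IsIsometricImmersion m g) (x : M)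
    (hx : mu m x = nu n g x + p) (X Y Z : TangentSpace (𝓡 n) x) : curvature m x X Y Z = 0 := by
  have : FiniteDimensional ℝ (TangentSpace (𝓡 n) x) :=
    inferInstanceAs (FiniteDimensional ℝ (Euc n))
  refine (hg.curvature_eq_zero_iff x X Y Z).2 fun U =>
    flat_of_finrank_eq (secondFundamentalForm g x) (hg.secondFundamentalForm_symm x) (nullity m x)
      (relativeNullity g x) (fun X hX Y Z U => ?_) (fun X hX => hX) ?_ X Y Z U
  · exact (hg.curvature_eq_zero_iff x X Y Z).1 (LinearMap.congr_fun (hX Y) Z) U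
  · rw [hg.finrank_normalSpace x]
    exact hx

end IsIsometricImmersion

end Manifold

end ChernKuiper

theorem mainTheorem6 {n p : ℕ} {M : Type*} [TopologicalSpace M]
    [ChartedSpace (ChernKuiper.Euc n) M] [IsManifold (𝓡 n) ∞ M]
    (m : ChernKuiper.Metric n M) (g : M → ChernKuiper.Euc (n + p))
    (hg : ChernKuiper.IsIsometricImmersion m g)
    (hμ : ∀ x : M, ChernKuiper.mu m x = ChernKuiper.nu n g x + p) :
    ChernKuiper.IsFlat m ∧
      ∀ x : M, ChernKuiper.mu m x = n ∧ ChernKuiper.nu n g x + p = n := by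
  have hflat : ChernKuiper.IsFlat m := fun x => hg.curvature_eq_zero x (hμ x)
  have hmu : ∀ x : M, ChernKuiper.mu m x = n := fun x => by
    have htop : ChernKuiper.nullity m x = ⊤ :=
      (Submodule.eq_top_iff').2 fun X Y => LinearMap.ext fun Z => hflat x X Y Z
    rw [ChernKuiper.mu, htop, finrank_top]
    exact finrank_euclideanSpace_fin
  exact ⟨hflat, fun x => ⟨hmu x, (hμ x).symm.trans (hmu x)⟩⟩
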